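/- Let $n \ge 1$ and $\lambda \ge 2$ be integers, and let $A$ be an $n\times n$ integer matrix whose entries are chosen independently and uniformly at random from the $\lambda+1$ contiguous integers $\{-\lfloor \lambda/2\rfloor, \dots, \lceil \lambda/2\rceil\}$. Let $s_1 \mid s_2 \mid \dots \mid s_n$, $s_i \ge 0$, be the invariant factors of $A$, that is, $A = U\,\mathrm{diag}(s_1,\dots,s_n)\,V$ with integer matrices $U, V$ of determinant $\pm 1$; call $s_i$ nontrivial if $s_i \ne 1$ (so zero invariant factors are counted as nontrivial). Then the expected number of nontrivial invariant factors of $A$ is at most $$\left\lceil \sqrt{2\log_\lambda n}\,\right\rceil + 3 .$$ Moreover, this bound is smaller than $3\lceil \log_\lambda n\rceil + 29$. -/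

import Mathlib

namespace RandomSmith

/-- `s` is the sequence of invariant factors of the square integer matrix `A`: the `s i` are
nonnegative, each divides the following ones, and `A = U * diag(s) * V` for integer matrices
`U`, `V` of determinant `1` or `-1`. -/
def IsInvariantFactors {n : ℕ} (A : Matrix (Fin n) (Fin n) ℤ) (s : Fin n → ℤ) : Prop :=
  (∀ i, 0 ≤ s i) ∧ (∀ i j, i ≤ j → s i ∣ s j) ∧
    ∃ U V : Matrix (Fin n) (Fin n) ℤ,
      (U.det = 1 ∨ U.det = -1) ∧ (V.det = 1 ∨ V.det = -1) ∧ A = U * Matrix.diagonal s * V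

/-! ### Existence of the Smith form, so that the invariant factors can be chosen -/

/-- Unimodular equivalence, used only in the existence proof. -/
def UEquiv {n : ℕ} (A B : Matrix (Fin n) (Fin n) ℤ) : Prop :=
  ∃ U V : Matrix (Fin n) (Fin n) ℤ, IsUnit U ∧ IsUnit V ∧ B = U * A * V

theorem UEquiv.refl {n : ℕ} (A : Matrix (Fin n) (Fin n) ℤ) : UEquiv A A :=
  ⟨1, 1, isUnit_one, isUnit_one, by simp⟩

theorem UEquiv.mul {n : ℕ} {A B : Matrix (Fin n) (Fin n) ℤ} (h : UEquiv A B)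
    {P Q : Matrix (Fin n) (Fin n) ℤ} (hP : IsUnit P) (hQ : IsUnit Q) : UEquiv A (P * B * Q) := by
  obtain ⟨U, V, hU, hV, rfl⟩ := h
  exact ⟨P * U, V * Q, hP.mul hU, hV.mul hQ, by simp only [Matrix.mul_assoc]⟩

theorem isUnit_one_add_vecMulVec {n : ℕ} (u w : Fin n → ℤ) (h : w ⬝ᵥ u = 0) :
    IsUnit (1 + Matrix.vecMulVec u w) := by
  have hN : Matrix.vecMulVec u w * Matrix.vecMulVec u w = 0 := by
    rw [Matrix.vecMulVec_mul_vecMulVec, h]; simp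
  refine ⟨⟨1 + Matrix.vecMulVec u w, 1 - Matrix.vecMulVec u w, ?_, ?_⟩, rfl⟩
  · rw [add_mul, mul_sub, mul_sub, hN]; simp
  · rw [sub_mul, mul_add, mul_add, hN]; simp

/-- Add `u i` times row `k` to each row `i`, where `u k = 0`. -/
theorem UEquiv.row {n : ℕ} {A B : Matrix (Fin n) (Fin n) ℤ} (h : UEquiv A B)
    (k : Fin n) (u : Fin n → ℤ) (hu : u k = 0) :
    UEquiv A (Matrix.of fun i j => B i j + u i * B k j) := by
  have := h.mul (isUnit_one_add_vecMulVec u (Pi.single k 1) (by simp [hu])) isUnit_one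
  convert this using 1
  ext i j
  simp [add_mul, Matrix.vecMulVec_mul]
  simp [Matrix.vecMulVec_apply]

/-- Add `u j` times column `k` to each column `j`, where `u k = 0`. -/
theorem UEquiv.col {n : ℕ} {A B : Matrix (Fin n) (Fin n) ℤ} (h : UEquiv A B)
    (k : Fin n) (u : Fin n → ℤ) (hu : u k = 0) :
    UEquiv A (Matrix.of fun i j => B i j + B i k * u j) := by
  have := h.mul isUnit_one (isUnit_one_add_vecMulVec (Pi.single k 1) u (by simp [hu]))
  convert this using 1
  ext i j
  simp [mul_add, Matrix.mul_vecMulVec]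
  simp [Matrix.vecMulVec_apply]

theorem UEquiv.perm {n : ℕ} {A B : Matrix (Fin n) (Fin n) ℤ} (h : UEquiv A B)
    (σ τ : Equiv.Perm (Fin n)) : UEquiv A (B.submatrix σ τ) := by
  have hu : ∀ ρ : Equiv.Perm (Fin n), IsUnit (ρ.toPEquiv.toMatrix : Matrix _ _ ℤ) := fun ρ => by
    rw [Matrix.isUnit_iff_isUnit_det, Int.isUnit_iff, ← Equiv.Perm.permMatrix,
      Matrix.det_permutation]
    rcases Int.units_eq_one_or (Equiv.Perm.sign ρ) with h | h <;> simp [h]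
  have := h.mul (hu σ) (hu τ.symm)
  convert this using 1
  ext i j
  rw [PEquiv.mul_toMatrix_toPEquiv, PEquiv.toMatrix_toPEquiv_mul]
  simp

/-- The block matrix with `d` in the corner and `M` below it on the diagonal. -/
def corner {n : ℕ} (d : ℤ) (M : Matrix (Fin n) (Fin n) ℤ) :
    Matrix (Fin (n + 1)) (Fin (n + 1)) ℤ :=
  Matrix.of (Fin.cons (Fin.cons d 0) fun i => Fin.cons 0 (M i))

theorem corner_mul {n : ℕ} (c d : ℤ) (M N : Matrix (Fin n) (Fin n) ℤ) :
    corner c M * corner d N = corner (c * d) (M * N) := by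
  ext i j
  refine Fin.cases ?_ (fun i => ?_) i <;> refine Fin.cases ?_ (fun j => ?_) j <;>
    simp [corner, Matrix.mul_apply, Fin.sum_univ_succ]

theorem corner_diagonal {n : ℕ} (d : ℤ) (s : Fin n → ℤ) :
    corner d (Matrix.diagonal s) = Matrix.diagonal (Fin.cons d s : Fin (n + 1) → ℤ) := by
  ext i j
  refine Fin.cases ?_ (fun i => ?_) i <;> refine Fin.cases ?_ (fun j => ?_) j <;>
    simp [corner, Matrix.diagonal_apply, Fin.succ_ne_zero, (Fin.succ_ne_zero _).symm]

theorem corner_one {n : ℕ} : corner 1 (1 : Matrix (Fin n) (Fin n) ℤ) = 1 := by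
  rw [← Matrix.diagonal_one, corner_diagonal, ← Matrix.diagonal_one]
  congr 1
  ext i
  refine Fin.cases ?_ (fun i => ?_) i <;> simp

theorem isUnit_corner {n : ℕ} {U : Matrix (Fin n) (Fin n) ℤ} (h : IsUnit U) :
    IsUnit (corner 1 U) := by
  obtain ⟨u, rfl⟩ := h
  exact ⟨⟨corner 1 u, corner 1 (↑u⁻¹ : Matrix _ _ ℤ), by rw [corner_mul]; simp [corner_one],
    by rw [corner_mul]; simp [corner_one]⟩, rfl⟩

/-- A nonzero matrix is equivalent to a block matrix whose corner divides all its entries. -/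
theorem exists_corner {n : ℕ} (A : Matrix (Fin (n + 1)) (Fin (n + 1)) ℤ) (hA : A ≠ 0) :
    ∃ (d : ℤ) (M : Matrix (Fin n) (Fin n) ℤ), UEquiv A (corner d M) ∧ ∀ i j, d ∣ M i j := by
  classical
  have hex : ∃ m : ℕ, ∃ B, UEquiv A B ∧ ∃ i j, B i j ≠ 0 ∧ (B i j).natAbs = m := by
    have : ∃ i j, A i j ≠ 0 := by
      by_contra! h
      exact hA (Matrix.ext h)
    obtain ⟨i, j, h⟩ := this
    exact ⟨_, A, UEquiv.refl A, i, j, h, rfl⟩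
  have hmin : ∀ B, UEquiv A B → ∀ i j, (B i j).natAbs < Nat.find hex → B i j = 0 := by
    intro B hB i j hlt
    by_contra h0
    exact Nat.find_min hex hlt ⟨B, hB, i, j, h0, rfl⟩
  obtain ⟨B, hB, i0, j0, hne, habs⟩ := Nat.find_spec hex
  have hC := hB.perm (Equiv.swap 0 i0) (Equiv.swap 0 j0)
  set C := B.submatrix (Equiv.swap 0 i0) (Equiv.swap 0 j0) with hCdef
  have hC0 : C 0 0 = B i0 j0 := by simp [hCdef]
  have hd : C 0 0 ≠ 0 := hC0 ▸ hne
  have hdm : (C 0 0).natAbs = Nat.find hex := hC0 ▸ habs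
  generalize hdd : C 0 0 = d at hd hdm
  have hrem : ∀ x : ℤ, (x % d).natAbs < Nat.find hex := by
    intro x
    have h1 := Int.emod_nonneg x hd
    have h2 := Int.emod_lt_abs x hd
    rw [← hdm]
    exact Int.natAbs_lt_natAbs_of_nonneg_of_lt h1 h2 |>.trans_eq (Int.natAbs_abs d)
  -- entries of the first column, and of the first row, reduce to zero
  have hcol : ∀ F, UEquiv A F → F 0 0 = d → ∀ i, d ∣ F i 0 := by
    intro F hF h0 i
    by_cases hi : i = 0
    · rw [hi, h0]
    have := hmin _ (hF.row 0 (Pi.single i (-(F i 0 / d))) (by simp [Ne.symm hi])) i 0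
    simp only [Matrix.of_apply, Pi.single_eq_same, h0] at this
    have he : F i 0 + -(F i 0 / d) * d = F i 0 % d := by
      rw [Int.emod_def]; ring
    rw [he] at this
    exact Int.dvd_of_emod_eq_zero (this (hrem _))
  have hrow : ∀ F, UEquiv A F → F 0 0 = d → ∀ j, d ∣ F 0 j := by
    intro F hF h0 j
    by_cases hj : j = 0
    · rw [hj, h0]
    have := hmin _ (hF.col 0 (Pi.single j (-(F 0 j / d))) (by simp [Ne.symm hj])) 0 j
    simp only [Matrix.of_apply, Pi.single_eq_same, h0] at this
    have he : F 0 j + d * -(F 0 j / d) = F 0 j % d := by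
      rw [Int.emod_def]; ring
    rw [he] at this
    exact Int.dvd_of_emod_eq_zero (this (hrem _))
  -- clear the first column, then the first row
  obtain ⟨D, hD, hD0, hDc⟩ : ∃ D, UEquiv A D ∧ D 0 0 = d ∧ ∀ i, i ≠ 0 → D i 0 = 0 := by
    refine ⟨_, hC.row 0 (fun i => if i = 0 then 0 else -(C i 0 / d)) (by simp), by simp [hdd], ?_⟩
    intro i hi
    have := Int.ediv_mul_cancel (hcol C hC hdd i)
    simp only [Matrix.of_apply, hi, if_false, hdd]
    linarith
  obtain ⟨E, hE, hE0, hEc, hEr⟩ : ∃ E, UEquiv A E ∧ E 0 0 = d ∧ (∀ i, i ≠ 0 → E i 0 = 0) ∧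
      ∀ j, j ≠ 0 → E 0 j = 0 := by
    refine ⟨_, hD.col 0 (fun j => if j = 0 then 0 else -(D 0 j / d)) (by simp), by simp [hD0],
      fun i hi => by simp [hDc i hi], ?_⟩
    intro j hj
    have := Int.mul_ediv_cancel' (hrow D hD hD0 j)
    simp only [Matrix.of_apply, hj, if_false, hD0]
    linarith
  refine ⟨d, E.submatrix Fin.succ Fin.succ, ?_, ?_⟩
  · convert hE using 1
    ext i j
    refine Fin.cases ?_ (fun i => ?_) i <;> refine Fin.cases ?_ (fun j => ?_) j <;>
      simp [corner, hE0, hEc, hEr, Fin.succ_ne_zero]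
  · intro i j
    have h := hrow _ (hE.row i.succ (Pi.single 0 1) (by simp [Fin.succ_ne_zero]))
      (by simp [hE0, hEc, Fin.succ_ne_zero]) j.succ
    simpa [hEr, Fin.succ_ne_zero] using h

theorem exists_smith {n : ℕ} (A : Matrix (Fin n) (Fin n) ℤ) :
    ∃ s : Fin n → ℤ, (∀ i j, i ≤ j → s i ∣ s j) ∧ UEquiv A (Matrix.diagonal s) := by
  induction n with
  | zero => exact ⟨0, fun i => i.elim0, by convert UEquiv.refl A using 1; ext i; exact i.elim0⟩
  | succ n ih =>
    by_cases hA : A = 0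
    · exact ⟨0, by simp, by subst hA; convert UEquiv.refl _ using 1; simp⟩
    obtain ⟨d, M, hM, hdvd⟩ := exists_corner A hA
    obtain ⟨s, hs, U, V, hU, hV, hUV⟩ := ih M
    refine ⟨Fin.cons d s, ?_, ?_⟩
    · have hds : ∀ i, d ∣ s i := by
        intro i
        have : s i = (U * M * V) i i := by rw [← hUV]; simp
        rw [this, Matrix.mul_apply]
        refine Finset.dvd_sum fun k _ => Dvd.dvd.mul_right ?_ _
        rw [Matrix.mul_apply]
        exact Finset.dvd_sum fun l _ => Dvd.dvd.mul_left (hdvd l k) _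
      intro i j
      refine Fin.cases ?_ (fun i => ?_) i <;> refine Fin.cases ?_ (fun j => ?_) j
      · simp
      · intro _; simpa using hds j
      · intro h; exact absurd h (by simp [Fin.succ_ne_zero])
      · intro h; simpa using hs i j (by simpa using h)
    · have := hM.mul (isUnit_corner hU) (isUnit_corner hV)
      rwa [corner_mul, corner_mul, ← hUV, one_mul, mul_one, corner_diagonal] at this

theorem exists_isInvariantFactors {n : ℕ} (A : Matrix (Fin n) (Fin n) ℤ) :
    ∃ s : Fin n → ℤ, IsInvariantFactors A s := by
  obtain ⟨s, hs, U, V, hU, hV, hUV⟩ := exists_smith A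
  obtain ⟨u, rfl⟩ := hU
  obtain ⟨v, rfl⟩ := hV
  have key : ∀ W : Matrix (Fin n) (Fin n) ℤ, IsUnit W → W.det = 1 ∨ W.det = -1 := fun W hW =>
    Int.isUnit_iff.1 ((Matrix.isUnit_iff_isUnit_det W).1 hW)
  let e : Fin n → ℤ := fun i => if s i < 0 then -1 else 1
  have he : ∀ i, e i * e i = 1 := fun i => by
    by_cases h : s i < 0 <;> simp [e, h]
  have hes : ∀ i, e i * |s i| = s i := fun i => by
    by_cases h : s i < 0
    · simp [e, h, abs_of_neg h]
    · simp [e, h, abs_of_nonneg (not_lt.1 h)]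
  have heu : IsUnit (Matrix.diagonal e) :=
    ⟨⟨Matrix.diagonal e, Matrix.diagonal e, by simp [Matrix.diagonal_mul_diagonal, he],
      by simp [Matrix.diagonal_mul_diagonal, he]⟩, rfl⟩
  refine ⟨fun i => |s i|, fun i => abs_nonneg _, fun i j hij => by simpa using hs i j hij,
    (↑u⁻¹ : Matrix _ _ ℤ) * Matrix.diagonal e, (↑v⁻¹ : Matrix _ _ ℤ),
    key _ ((Units.isUnit _).mul heu), key _ (Units.isUnit _), ?_⟩
  have h1 : Matrix.diagonal e * Matrix.diagonal (fun i => |s i|) = Matrix.diagonal s := by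
    rw [Matrix.diagonal_mul_diagonal]; simp only [hes]
  calc A = (↑u⁻¹ : Matrix _ _ ℤ) * (↑u * A * ↑v) * (↑v⁻¹ : Matrix _ _ ℤ) := by
        simp only [← mul_assoc, Units.inv_mul, one_mul]
        simp only [mul_assoc, Units.mul_inv, mul_one]
    _ = _ := by rw [← hUV, ← h1]; simp only [mul_assoc]

/-- The invariant factors `s₁ ∣ s₂ ∣ … ∣ sₙ` of `A`, normalised to be nonnegative. -/
noncomputable def invariantFactors {n : ℕ} (A : Matrix (Fin n) (Fin n) ℤ) : Fin n → ℤ :=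
  Classical.choose (exists_isInvariantFactors A)

theorem invariantFactors_spec {n : ℕ} (A : Matrix (Fin n) (Fin n) ℤ) :
    IsInvariantFactors A (invariantFactors A) :=
  Classical.choose_spec (exists_isInvariantFactors A)

/-- The number of invariant factors different from `1` (zero invariant factors are counted). -/
noncomputable def numNontrivial {n : ℕ} (A : Matrix (Fin n) (Fin n) ℤ) : ℕ :=
  (Finset.univ.filter fun i => invariantFactors A i ≠ 1).card

/-- The contiguous integers `-⌊l/2⌋, …, ⌈l/2⌉`. -/
noncomputable def entrySet (l : ℕ) : Finset ℤ :=
  Finset.Icc (-⌊(l : ℚ) / 2⌋) ⌈(l : ℚ) / 2⌉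

/-- The `n × n` integer matrices all of whose entries lie in `entrySet l`. -/
noncomputable def matrixSet (n l : ℕ) : Finset (Matrix (Fin n) (Fin n) ℤ) :=
  (Fintype.piFinset fun _ : Fin n => Fintype.piFinset fun _ : Fin n => entrySet l).map
    Matrix.of.toEmbedding

/-- The expected value of `f A`, where the entries of the `n × n` matrix `A` are chosen
independently and uniformly from `entrySet l`, i.e. `A` is uniform on `matrixSet n l`. -/
noncomputable def expectedValue (n l : ℕ) (f : Matrix (Fin n) (Fin n) ℤ → ℝ) : ℝ :=
  (∑ A ∈ matrixSet n l, f A) / (matrixSet n l).card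

end RandomSmith

/-!
The number of nontrivial invariant factors of `A` is the nullity of `A` modulo some prime: a prime
dividing the first nontrivial invariant factor divides all of them
(`exists_prime_numNontrivial_le`). So it suffices to bound the expected maximum over all primes of
the nullity modulo `p`. The rows of `A` are exposed one at a time. If the residues of an entry
modulo `p` have point probabilities at most `β`, then a new row lies in a given subspace of
codimension `c` with probability at most `β ^ c` (`prob_mem_submodule_le`), and the recursion of
`prob_excess_succ_le` shows that the nullity is at least `j` with probability at most
`(1 - β)⁻¹ ^ j * β ^ (j ^ 2)` (`tail_recursion`). The same holds for the rational nullity.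

For `p ≤ l` one can take `β = 2 / (p + 1)` (`prob_intCast_zmod_eq_le`), and the bounds are summable
over `p`. For `p > l` and over `ℚ` one can take `β = 1 / (l + 1)`, but the union bound over the
infinitely many large primes fails. Instead, the nullity modulo `p` is split into the rational
nullity, whose expectation is at most `5 / 9`, and the excess of the rational rank over the rank
modulo `p`. At every stage the excess is positive only for primes dividing a nonzero Gram
determinant, hence for at most `2 * n ^ 2` primes `p > l` (`card_rowRank_lt_le`). Once it is
positive, the recursion applies to it again, so the expected number of large primes with final
excess greater than `j` is at most `2 * n ^ 2 * (1 - β)⁻¹ ^ j * β ^ (j * (j + 1))`. With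
`k = ⌈√(2 log_l n)⌉` one has `n ^ 2 ≤ l ^ (k ^ 2)`, so for `j ≥ k + 2` this is negligible.

Altogether the expectation is at most `k + 2`, plus the rational nullity, plus the amounts by which
the nullities modulo small primes exceed `3`, plus the amounts by which the excesses at large primes
exceed `k + 2`; the last three terms sum to less than `1`
(`expectedValue_numNontrivial_le`).
-/

namespace RandomSmith

open Finset Module
open scoped BigOperators Classical

/-! ### Averages over tuples and the small ball estimate -/

/-- Averaging over `(m + 1)`-tuples: expose the last `m` entries first, then the initial one. -/
theorem expect_fin_cons {X : Type*} [Fintype X] {m : ℕ} (F : (Fin (m + 1) → X) → ℝ) :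
    𝔼 A, F A = 𝔼 A : Fin m → X, 𝔼 x : X, F (Fin.cons x A) := by
  rw [expect_comm, ← expect_product (univ : Finset X) (univ : Finset (Fin m → X))
    (fun z => F (Fin.cons z.1 z.2)), univ_product_univ]
  exact (Fintype.expect_equiv (Fin.consEquiv fun _ => X) _ _ fun z => rfl).symm

/-- The probability of the event `E` under the uniform distribution on the finite type `Ω`. -/
noncomputable def prob {Ω : Type*} [Fintype Ω] (E : Ω → Prop) : ℝ :=
  𝔼 x, if E x then (1 : ℝ) else 0

theorem prob_nonneg {Ω : Type*} [Fintype Ω] (E : Ω → Prop) : 0 ≤ prob E :=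
  expect_nonneg fun x _ => by positivity

theorem prob_mono {Ω : Type*} [Fintype Ω] {E F : Ω → Prop} (h : ∀ x, E x → F x) :
    prob E ≤ prob F := by
  refine expect_le_expect fun x _ => ?_
  by_cases hE : E x
  · simp [hE, h x hE]
  · simp only [hE, if_false]; positivity

/-- If the reductions of the entries take every value in `K` with probability at most `β`, then
a vector with independent entries reduces into a subspace `W` with probability at most `β` to the
codimension of `W`. -/
theorem prob_mem_submodule_le {K : Type*} [Field K] {σ : Type*} [Fintype σ] [Nonempty σ]
    {g : σ → K} {β : ℝ} (hβ : ∀ c, prob (fun x => g x = c) ≤ β) (hβ1 : β ≤ 1) {n : ℕ}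
    (W : Submodule K (Fin n → K)) :
    prob (fun v : Fin n → σ => g ∘ v ∈ W) ≤ β ^ (n - finrank K W) := by
  have hβ0 : 0 ≤ β := (prob_nonneg _).trans (hβ 0)
  induction n with
  | zero =>
    rw [zero_tsub, pow_zero]
    exact expect_le univ_nonempty fun x _ => by split_ifs <;> simp
  | succ n ih =>
    set T : (Fin (n + 1) → K) →ₗ[K] (Fin n → K) := LinearMap.funLeft K K Fin.succ with hT
    have hcons : ∀ (x : σ) (v : Fin n → σ),
        T (g ∘ (Fin.cons x v : Fin (n + 1) → σ)) = g ∘ v := by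
      intro x v
      ext i
      simp [hT, LinearMap.funLeft_apply]
    set W' := W.map T with hW'
    have hmem : ∀ (x : σ) (v : Fin n → σ), g ∘ (Fin.cons x v : Fin (n + 1) → σ) ∈ W → g ∘ v ∈ W' :=
      fun x v h => hcons x v ▸ Submodule.mem_map_of_mem h
    have hT0 : ∀ w, T w = 0 → w = w 0 • Pi.single 0 1 := by
      intro w hw
      ext i
      refine Fin.cases ?_ (fun i => ?_) i
      · simp
      · have := congrFun hw i
        simpa [hT, LinearMap.funLeft_apply, Fin.succ_ne_zero] using this
    unfold prob
    rw [expect_fin_cons]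
    by_cases he : (Pi.single 0 1 : Fin (n + 1) → K) ∈ W
    · -- the first entry is unconstrained, but the dimension drops under projection
      have hdim : finrank K W' + 1 ≤ finrank K W := by
        have h1 := LinearMap.finrank_range_add_finrank_ker (T.domRestrict W)
        have h2 : LinearMap.range (T.domRestrict W) = W' := by
          rw [hW', LinearMap.range_domRestrict]
        have h3 : LinearMap.ker (T.domRestrict W) ≠ ⊥ := by
          intro h
          have : (⟨_, he⟩ : W) ∈ LinearMap.ker (T.domRestrict W) := by
            rw [LinearMap.mem_ker]
            ext i
            simp [hT, LinearMap.funLeft_apply, Fin.succ_ne_zero]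
          rw [h, Submodule.mem_bot] at this
          have := congrFun (congrArg Subtype.val this) 0
          simp at this
        have h4 := Submodule.one_le_finrank_iff.2 h3
        rw [h2] at h1
        omega
      calc _ ≤ 𝔼 v : Fin n → σ, if g ∘ v ∈ W' then (1 : ℝ) else 0 := by
            refine expect_le_expect fun v _ => expect_le univ_nonempty fun x _ => ?_
            by_cases h : g ∘ (Fin.cons x v : Fin (n + 1) → σ) ∈ W
            · simp [h, hmem x v h]
            · simp only [h, if_false]; positivity
        _ ≤ β ^ (n - finrank K W') := ih W'
        _ ≤ _ := pow_le_pow_of_le_one hβ0 hβ1 (by omega)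
    · -- the first entry is determined modulo the kernel of the reduction
      have hdim : finrank K W' ≤ finrank K W := Submodule.finrank_map_le _ _
      calc _ ≤ 𝔼 v : Fin n → σ, β * if g ∘ v ∈ W' then (1 : ℝ) else 0 := by
            refine expect_le_expect fun v _ => ?_
            by_cases h : ∃ x, g ∘ (Fin.cons x v : Fin (n + 1) → σ) ∈ W
            · obtain ⟨x, hx⟩ := h
              simp only [hmem x v hx, if_true, mul_one]
              refine le_trans (prob_mono fun y hy => ?_) (hβ (g x))
              by_contra hne
              have hd := W.sub_mem hy hx
              have h0 := hT0 (g ∘ (Fin.cons y v : Fin (n + 1) → σ) -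
                g ∘ (Fin.cons x v : Fin (n + 1) → σ))
                (by rw [map_sub, hcons y v, hcons x v, sub_self])
              rw [h0] at hd
              refine he ((W.smul_mem_iff ?_).1 hd)
              simpa [sub_eq_zero] using hne
            · rw [not_exists] at h
              simp only [h, if_false, expect_const_zero]
              positivity
        _ = β * 𝔼 v : Fin n → σ, if g ∘ v ∈ W' then (1 : ℝ) else 0 := by rw [mul_expect]
        _ ≤ β * β ^ (n - finrank K W') := mul_le_mul_of_nonneg_left (ih W') hβ0
        _ = β ^ (n - finrank K W' + 1) := by ring
        _ ≤ _ := pow_le_pow_of_le_one hβ0 hβ1 (by omega)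

/-! ### Ranks of random rows -/

/-- The rank over `K` of the matrix with rows `A i`, after applying `g` to every entry. -/
noncomputable def rowRank {K : Type*} [Field K] {σ : Type*} (g : σ → K) {n t : ℕ}
    (A : Fin t → Fin n → σ) : ℕ :=
  (Set.range fun i => g ∘ A i).finrank K

theorem range_comp_cons {K σ : Type*} (g : σ → K) {n t : ℕ} (v : Fin n → σ)
    (A : Fin t → Fin n → σ) :
    (Set.range fun i => g ∘ (Fin.cons v A : Fin (t + 1) → Fin n → σ) i) =
      insert (g ∘ v) (Set.range fun i => g ∘ A i) := by
  rw [← Fin.range_cons]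
  congr 1
  ext i j
  refine Fin.cases ?_ (fun i => ?_) i <;> simp

section rowRank

variable {K : Type*} [Field K] {σ : Type*} (g : σ → K) {n t : ℕ}

theorem rowRank_le (A : Fin t → Fin n → σ) : rowRank g A ≤ t :=
  (finrank_range_le_card (R := K) fun i => g ∘ A i).trans_eq (Fintype.card_fin t)

theorem rowRank_cons_of_mem {v : Fin n → σ} {A : Fin t → Fin n → σ}
    (h : g ∘ v ∈ Submodule.span K (Set.range fun i => g ∘ A i)) :
    rowRank g (Fin.cons v A : Fin (t + 1) → Fin n → σ) = rowRank g A := by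
  rw [rowRank, rowRank, Set.finrank, Set.finrank, range_comp_cons, Submodule.span_insert_eq_span h]

theorem rowRank_cons_of_notMem {v : Fin n → σ} {A : Fin t → Fin n → σ}
    (h : g ∘ v ∉ Submodule.span K (Set.range fun i => g ∘ A i)) :
    rowRank g (Fin.cons v A : Fin (t + 1) → Fin n → σ) = rowRank g A + 1 := by
  rw [rowRank, rowRank, Set.finrank, Set.finrank, range_comp_cons, Submodule.span_insert, sup_comm,
    Submodule.finrank_sup_span_singleton h]

theorem rowRank_cons_le (v : Fin n → σ) (A : Fin t → Fin n → σ) :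
    rowRank g (Fin.cons v A : Fin (t + 1) → Fin n → σ) ≤ rowRank g A + 1 := by
  by_cases h : g ∘ v ∈ Submodule.span K (Set.range fun i => g ∘ A i)
  · rw [rowRank_cons_of_mem g h]; omega
  · rw [rowRank_cons_of_notMem g h]

variable {g} [Fintype σ] [Nonempty σ] {β : ℝ}

/-- One exposure step. Here `R` is a reference rank, which grows by at most one with each row. Its
excess over the rank in `K` can only exceed `j` if it already did, or if it was `j` and the new row
lies in the span of the old ones, a subspace of codimension at least `n - t + j`. -/
theorem prob_excess_succ_le (hβ : ∀ c, prob (fun x => g x = c) ≤ β) (hβ1 : β ≤ 1) (htn : t ≤ n)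
    {R : (Fin t → Fin n → σ) → ℕ} {R' : (Fin (t + 1) → Fin n → σ) → ℕ} (hR : ∀ A, R A ≤ t)
    (hR' : ∀ v A, R' (Fin.cons v A) ≤ R A + 1) (j : ℕ) :
    prob (fun A => R' A ≥ rowRank g A + (j + 1)) ≤
      prob (fun A => R A ≥ rowRank g A + (j + 1)) +
        β ^ (n - t + j) * prob (fun A => R A ≥ rowRank g A + j) := by
  have hβ0 : 0 ≤ β := (prob_nonneg _).trans (hβ 0)
  unfold prob
  rw [expect_fin_cons, mul_expect, ← expect_add_distrib]
  refine expect_le_expect fun A _ => ?_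
  by_cases h1 : R A ≥ rowRank g A + (j + 1)
  · simp only [h1, if_true]
    exact le_trans (expect_le (a := 1) univ_nonempty fun v _ => by split_ifs <;> simp)
      (le_add_of_nonneg_right (by positivity))
  simp only [h1, if_false, zero_add]
  by_cases h2 : R A ≥ rowRank g A + j
  · simp only [h2, if_true, mul_one]
    refine le_trans (prob_mono (F := fun v => g ∘ v ∈
      Submodule.span K (Set.range fun i => g ∘ A i)) fun v hv => ?_)
      ((prob_mem_submodule_le hβ hβ1 _).trans ?_)
    · by_contra hn
      rw [rowRank_cons_of_notMem g hn] at hv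
      have := hR' v A
      omega
    · refine pow_le_pow_of_le_one hβ0 hβ1 ?_
      have := hR A
      change _ ≤ n - rowRank g A
      omega
  · simp only [h2, if_false, mul_zero]
    refine expect_le univ_nonempty fun v _ => ?_
    rw [if_neg]
    intro hv
    have := hR' v A
    by_cases hm : g ∘ v ∈ Submodule.span K (Set.range fun i => g ∘ A i)
    · rw [rowRank_cons_of_mem g hm] at hv
      omega
    · rw [rowRank_cons_of_notMem g hm] at hv
      omega

end rowRank

/-! ### Tail bounds for nullities and excesses -/

theorem prob_le_one {Ω : Type*} [Fintype Ω] [Nonempty Ω] (E : Ω → Prop) : prob E ≤ 1 :=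
  expect_le univ_nonempty fun x _ => by split_ifs <;> simp

/-- The solution of the recursion satisfied by the tails of nullities (`s = 0`, `N = 1`) and of
excesses of rational ranks over ranks modulo primes (`s = 1`). -/
theorem tail_recursion {β N : ℝ} (hβ0 : 0 ≤ β) (hβ1 : β < 1) (hN0 : 0 ≤ N) {n s : ℕ}
    (x : ℕ → ℕ → ℝ) (hN : ∀ t ≤ n, x t 0 ≤ N) (h0 : ∀ j, x 0 (j + 1) ≤ 0)
    (hstep : ∀ t < n, ∀ j, x (t + 1) (j + 1) ≤ x t (j + 1) + β ^ (n - t + j + s) * x t j) :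
    ∀ t ≤ n, ∀ j, x t j ≤ N * ((1 - β)⁻¹ ^ j * β ^ (j * (n - t + j + s))) := by
  have h1β : 0 < 1 - β := by linarith
  intro t
  induction t with
  | zero =>
    rintro - (_ | j)
    · simpa using hN 0 (Nat.zero_le _)
    · exact (h0 j).trans (by positivity)
  | succ t ih =>
    rintro ht (_ | j)
    · simpa using hN _ ht
    obtain ⟨m, rfl⟩ := Nat.exists_eq_add_of_le ht
    have e1 : t + 1 + m - t = m + 1 := by omega
    have e2 : t + 1 + m - (t + 1) = m := by omega
    have i1 := ih (by omega) (j + 1)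
    have i2 := ih (by omega) j
    have i3 := hstep t (by omega) j
    rw [e1] at i1 i2 i3
    rw [e2]
    set c := (1 - β)⁻¹ with hc
    have hc0 : 0 < c := inv_pos.2 h1β
    have hcβ : c * β + 1 = c := by rw [hc]; field_simp; ring
    set Y := β ^ ((j + 1) * (m + (j + 1) + s)) with hY
    have hY0 : 0 ≤ Y := by positivity
    have k1 : β ^ ((j + 1) * (m + 1 + (j + 1) + s)) ≤ β * Y := by
      rw [hY, ← pow_succ']
      exact pow_le_pow_of_le_one hβ0 hβ1.le (by nlinarith)
    have k2 : β ^ (m + 1 + j + s) * β ^ (j * (m + 1 + j + s)) = Y := by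
      rw [hY, ← pow_add]; congr 1; ring
    calc _ ≤ _ := i3
      _ ≤ N * (c ^ (j + 1) * (β * Y)) + β ^ (m + 1 + j + s) *
          (N * (c ^ j * β ^ (j * (m + 1 + j + s)))) := by gcongr; exact i1.trans (by gcongr)
      _ = N * (c ^ j * ((c * β + 1) * Y)) := by rw [← k2]; ring
      _ = _ := by rw [hcβ]; ring

/-- The quotients of consecutive tail bounds decrease. If the first one is at most `1 / 10`, then the
sum of the bounds is at most `10 / 9` times the first bound. -/
theorem sum_tail_le {β : ℝ} (hβ0 : 0 ≤ β) (hβ1 : β < 1) {K s : ℕ}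
    (hq : (1 - β)⁻¹ * β ^ (2 * K + 1 + s) ≤ 1 / 10) (M : ℕ) :
    ∑ i ∈ range M, (1 - β)⁻¹ ^ (K + i) * β ^ ((K + i) * (K + i + s)) ≤
      10 / 9 * ((1 - β)⁻¹ ^ K * β ^ (K * (K + s))) := by
  have h1β : 0 < 1 - β := by linarith
  set c := (1 - β)⁻¹ with hc
  have hc0 : 0 < c := inv_pos.2 h1β
  set a := c ^ K * β ^ (K * (K + s)) with ha
  have ha0 : 0 ≤ a := by positivity
  have hterm : ∀ i, c ^ (K + i) * β ^ ((K + i) * (K + i + s)) ≤ a * (1 / 10) ^ i := by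
    intro i
    induction i with
    | zero => simp [ha]
    | succ i ih =>
      have e : c ^ (K + (i + 1)) * β ^ ((K + (i + 1)) * (K + (i + 1) + s)) =
          (c ^ (K + i) * β ^ ((K + i) * (K + i + s))) * (c * β ^ (2 * K + 1 + s) * β ^ (2 * i)) := by
        ring
      calc _ = _ := e
        _ ≤ a * (1 / 10) ^ i * (1 / 10 * 1) := by
            gcongr
            exact pow_le_one₀ hβ0 hβ1.le
        _ = _ := by ring
  have hgeo : ∀ M : ℕ, ∑ i ∈ range M, (1 / 10 : ℝ) ^ i ≤ 10 / 9 := by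
    intro M
    have : (0 : ℝ) ≤ (1 / 10) ^ M := by positivity
    have h := geom_sum_eq (show (1 / 10 : ℝ) ≠ 1 by norm_num) M
    rw [h, div_le_iff_of_neg (by norm_num)]
    linarith
  calc _ ≤ ∑ i ∈ range M, a * (1 / 10) ^ i := sum_le_sum fun i _ => hterm i
    _ = a * ∑ i ∈ range M, (1 / 10 : ℝ) ^ i := by rw [mul_sum]
    _ ≤ a * (10 / 9) := by gcongr; exact hgeo M
    _ = _ := by ring

theorem sum_prob_eq {Ω ι : Type*} [Fintype Ω] (P : Finset ι) (E : ι → Ω → Prop)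
    [∀ x, DecidablePred fun i => E i x] :
    ∑ i ∈ P, prob (E i) = 𝔼 x, (#{i ∈ P | E i x} : ℝ) := by
  unfold prob
  rw [← expect_sum_comm]
  refine expect_congr rfl fun x _ => ?_
  rw [← sum_boole]
  congr!

/-- The expectation of a truncated difference as a sum of tail probabilities. -/
theorem expect_sub_le_sum_prob {Ω : Type*} [Fintype Ω] {R r : Ω → ℕ} {M K : ℕ}
    (hM : ∀ x, R x ≤ M) :
    𝔼 x, ((R x - r x - K : ℕ) : ℝ) ≤ ∑ i ∈ range M, prob fun x => R x ≥ r x + (K + i + 1) := by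
  rw [sum_prob_eq]
  refine expect_le_expect fun x _ => ?_
  have : range (R x - r x - K) ⊆ {i ∈ range M | R x ≥ r x + (K + i + 1)} := by
    intro i hi
    have := hM x
    simp only [mem_filter, mem_range] at hi ⊢
    omega
  have := card_le_card this
  rw [card_range] at this
  exact_mod_cast this

section

variable {K : Type*} [Field K] {σ : Type*} [Fintype σ] [Nonempty σ] {g : σ → K} {β : ℝ}

/-- The expected amount by which the nullity of a random square matrix exceeds `k`. -/
theorem expect_nullity_le (hβ : ∀ c, prob (fun x => g x = c) ≤ β) (hβ1 : β < 1) {n k : ℕ}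
    (hq : (1 - β)⁻¹ * β ^ (2 * k + 3) ≤ 1 / 10) :
    𝔼 A : Fin n → Fin n → σ, ((n - rowRank g A - k : ℕ) : ℝ) ≤
      10 / 9 * ((1 - β)⁻¹ ^ (k + 1) * β ^ ((k + 1) * (k + 1))) := by
  have hβ0 : 0 ≤ β := (prob_nonneg _).trans (hβ 0)
  refine (expect_sub_le_sum_prob (R := fun _ => n) (M := n) fun _ => le_rfl).trans ?_
  refine le_trans (sum_le_sum fun i _ => ?_)
    (sum_tail_le (K := k + 1) (s := 0) hβ0 hβ1 (by simpa [mul_add, add_assoc] using hq) n)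
  have := tail_recursion (n := n) (s := 0) hβ0 hβ1 zero_le_one
    (fun t j => prob fun A : Fin t → Fin n → σ => t ≥ rowRank g A + j)
    (fun t _ => prob_le_one _)
    (fun j => (expect_eq_zero fun A _ => if_neg (by omega)).le)
    (fun t ht j => prob_excess_succ_le hβ hβ1.le ht.le (R := fun _ => t) (R' := fun _ => t + 1)
      (fun _ => le_rfl) (fun _ _ => le_rfl) j) n le_rfl (k + 1 + i)
  rw [show k + i + 1 = k + 1 + i by ring]
  simpa using this

end

/-- The expected total amount by which the excesses of the rational rank over the ranks in the
fields `K i` exceed `k`, if at most `N` of these excesses are ever positive. -/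
theorem sum_expect_excess_le {σ : Type*} [Fintype σ] [Nonempty σ] {F : Type*} [Field F]
    (f : σ → F) {ι : Type*} (P : Finset ι) {K : ι → Type*} [∀ i, Field (K i)] (g : ∀ i, σ → K i)
    {β N : ℝ} (hβ0 : 0 ≤ β) (hβ : ∀ i ∈ P, ∀ c, prob (fun x => g i x = c) ≤ β) (hβ1 : β < 1)
    {n k : ℕ}
    (hN : ∀ t ≤ n, ∀ A : Fin t → Fin n → σ, (#{i ∈ P | rowRank (g i) A < rowRank f A} : ℝ) ≤ N)
    (hq : (1 - β)⁻¹ * β ^ (2 * k + 2) ≤ 1 / 10) :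
    ∑ i ∈ P, 𝔼 A : Fin n → Fin n → σ, ((rowRank f A - rowRank (g i) A - k : ℕ) : ℝ) ≤
      10 / 9 * (N * ((1 - β)⁻¹ ^ k * β ^ (k * (k + 1)))) := by
  have hN0 : 0 ≤ N := (Nat.cast_nonneg _).trans (hN 0 (Nat.zero_le _) default)
  calc _ ≤ ∑ i ∈ P, ∑ j ∈ range n, prob fun A : Fin n → Fin n → σ =>
          rowRank f A ≥ rowRank (g i) A + (k + j + 1) :=
        sum_le_sum fun i _ => expect_sub_le_sum_prob fun A => rowRank_le f A
    _ = ∑ j ∈ range n, ∑ i ∈ P, prob fun A : Fin n → Fin n → σ =>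
          rowRank f A ≥ rowRank (g i) A + (k + j + 1) := sum_comm
    _ ≤ ∑ j ∈ range n, N * ((1 - β)⁻¹ ^ (k + j) * β ^ ((k + j) * (k + j + 1))) := by
        refine sum_le_sum fun j _ => ?_
        have := tail_recursion (n := n) (s := 1) hβ0 hβ1 hN0
          (fun t j => ∑ i ∈ P, prob fun A : Fin t → Fin n → σ =>
            rowRank f A ≥ rowRank (g i) A + (j + 1))
          (fun t ht => ?_) (fun j => (sum_eq_zero fun i _ => expect_eq_zero fun A _ => ?_).le)
          (fun t ht j => ?_) n le_rfl (k + j)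
        · simpa using this
        · rw [sum_prob_eq]
          refine expect_le univ_nonempty fun A _ => ?_
          exact hN t ht A
        · have := rowRank_le f A
          exact if_neg (by omega)
        · rw [mul_sum, ← sum_add_distrib]
          refine sum_le_sum fun i hi => ?_
          exact prob_excess_succ_le (hβ i hi) hβ1.le ht.le (R := rowRank f) (R' := rowRank f)
            (rowRank_le f) (rowRank_cons_le f) (j + 1)
    _ = N * ∑ j ∈ range n, (1 - β)⁻¹ ^ (k + j) * β ^ ((k + j) * (k + j + 1)) := by rw [mul_sum]
    _ ≤ N * (10 / 9 * ((1 - β)⁻¹ ^ k * β ^ (k * (k + 1)))) := by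
        gcongr
        exact sum_tail_le hβ0 hβ1 (by convert hq using 3) n
    _ = _ := by ring

/-! ### Primes at which the rank drops -/

/-- If an integer matrix drops rank modulo `p`, then `p` divides the Gram determinant of a maximal
set of rationally independent rows. This determinant is not zero, and its size is at most
`(t * n * b ^ 2) ^ r`, where `r` is the rational rank and `b` bounds the entries. -/
theorem exists_ne_zero_dvd_of_rowRank_lt {σ : Type*} (a : σ → ℤ) {b : ℕ} (hb : ∀ x, |a x| ≤ b)
    {n t : ℕ} (A : Fin t → Fin n → σ) :
    ∃ G : ℤ, G ≠ 0 ∧ |G| ≤ (t * (n * b ^ 2) : ℤ) ^ (rowRank (fun x => (a x : ℚ)) A) ∧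
      ∀ (p : ℕ) [Fact p.Prime],
        rowRank (fun x => (a x : ZMod p)) A < rowRank (fun x => (a x : ℚ)) A → (p : ℤ) ∣ G := by
  obtain ⟨κ, e, he, hspan, hli⟩ :=
    exists_linearIndependent' ℚ fun i : Fin t => (fun x => (a x : ℚ)) ∘ A i
  have : Finite κ := Finite.of_injective e he
  have : Fintype κ := Fintype.ofFinite κ
  have hcard : Fintype.card κ = rowRank (fun x => (a x : ℚ)) A := by
    rw [rowRank, Set.finrank, ← hspan]
    exact (finrank_span_eq_card hli).symm
  have hcard_le : Fintype.card κ ≤ t := hcard ▸ rowRank_le _ _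
  let B : Matrix κ (Fin n) ℤ := Matrix.of fun i j => a (A (e i) j)
  have hmap : ∀ (K : Type) [Field K], ((B * B.transpose).det : K) =
      (B.map (Int.cast : ℤ → K) * (B.map (Int.cast : ℤ → K)).transpose).det := by
    intro K _
    have h1 := RingHom.map_det (Int.castRingHom K) (B * B.transpose)
    rw [RingHom.mapMatrix_apply, Matrix.map_mul] at h1
    exact h1
  refine ⟨(B * B.transpose).det, ?_, ?_, ?_⟩
  · intro h0
    have h1 := hmap ℚ
    rw [h0, Int.cast_zero] at h1
    have h2 : (B.map (Int.cast : ℤ → ℚ)).rank = Fintype.card κ :=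
      LinearIndependent.rank_matrix hli
    rw [← Matrix.rank_self_mul_transpose] at h2
    have h3 := Matrix.linearIndependent_rows_iff_isUnit.1
      (linearIndependent_iff_card_eq_finrank_span.2 (h2.symm.trans
        (Matrix.rank_eq_finrank_span_row _)))
    rw [Matrix.isUnit_iff_isUnit_det, ← h1] at h3
    exact not_isUnit_zero h3
  · have hentry : ∀ i j, AbsoluteValue.abs ((B * B.transpose) i j) ≤ (n * b ^ 2 : ℤ) := by
      intro i j
      rw [AbsoluteValue.abs_apply, Matrix.mul_apply]
      calc _ ≤ ∑ k : Fin n, |B i k * B.transpose k j| := abs_sum_le_sum_abs _ _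
        _ ≤ ∑ k : Fin n, (b ^ 2 : ℤ) := by
            refine sum_le_sum fun k _ => ?_
            rw [abs_mul, sq]
            exact mul_le_mul (hb _) (hb _) (abs_nonneg _) (by positivity)
        _ = _ := by simp
    refine (Matrix.det_le hentry).trans ?_
    rw [hcard, nsmul_eq_mul, mul_pow (t : ℤ)]
    refine mul_le_mul_of_nonneg_right ?_ (pow_nonneg (by positivity : (0 : ℤ) ≤ n * b ^ 2) _)
    rw [← hcard]
    calc ((Fintype.card κ).factorial : ℤ) ≤ (Fintype.card κ : ℤ) ^ Fintype.card κ := by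
          exact_mod_cast Nat.factorial_le_pow _
      _ ≤ _ := by gcongr
  · intro p hp hlt
    by_contra hdvd
    rw [← ZMod.intCast_zmod_eq_zero_iff_dvd, hmap (ZMod p), ← ne_eq, ← isUnit_iff_ne_zero,
      ← Matrix.isUnit_iff_isUnit_det] at hdvd
    have h1 := Matrix.rank_of_isUnit _ hdvd
    have h2 := Matrix.rank_mul_le_left (B.map (Int.cast : ℤ → ZMod p))
      (B.map (Int.cast : ℤ → ZMod p)).transpose
    rw [h1, Matrix.rank_eq_finrank_span_row] at h2
    have h3 : finrank (ZMod p) (Submodule.span (ZMod p)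
        (Set.range (B.map (Int.cast : ℤ → ZMod p)).row)) ≤
        rowRank (fun x => (a x : ZMod p)) A := by
      refine Submodule.finrank_mono (Submodule.span_mono ?_)
      rintro _ ⟨i, rfl⟩
      exact ⟨e i, rfl⟩
    omega

instance fact_prime_coe (p : Nat.Primes) : Fact (p : ℕ).Prime := ⟨p.2⟩

/-- There are at most `2 * n ^ 2` primes `p > l` at which the rank of a given matrix with `n`
columns, at most `n` rows and entries of absolute value at most `l` drops. -/
theorem card_rowRank_lt_le {σ : Type*} (a : σ → ℤ) {l : ℕ} (hl : 2 ≤ l) (ha : ∀ x, |a x| ≤ l)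
    {n t : ℕ} (htn : t ≤ n) (A : Fin t → Fin n → σ) (P : Finset Nat.Primes)
    (hP : ∀ p ∈ P, l < (p : ℕ)) :
    #(P.filter fun p : Nat.Primes =>
      rowRank (fun x => (a x : ZMod p)) A < rowRank (fun x => (a x : ℚ)) A) ≤ 2 * n ^ 2 := by
  rcases Nat.eq_zero_or_pos n with rfl | hn
  · obtain rfl : t = 0 := by omega
    rw [card_eq_zero.2]
    · omega
    refine filter_eq_empty_iff.2 fun p _ => ?_
    have := rowRank_le (fun x => (a x : ℚ)) A
    omega
  obtain ⟨G, hG0, hG, hdvd⟩ := exists_ne_zero_dvd_of_rowRank_lt a ha A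
  set Q : Finset Nat.Primes := _
  change #Q ≤ 2 * n ^ 2
  have hprod : ∏ p ∈ Q.map ⟨fun p : Nat.Primes => (p : ℕ), Subtype.val_injective⟩, p ∣ G.natAbs := by
    refine prod_primes_dvd _ ?_ ?_
    · intro q hq
      obtain ⟨p, -, rfl⟩ := mem_map.1 hq
      exact p.2.prime
    · intro q hq
      obtain ⟨p, hp, rfl⟩ := mem_map.1 hq
      exact Int.natCast_dvd.1 (hdvd p (mem_filter.1 hp).2)
  rw [prod_map] at hprod
  have h1 : l ^ #Q ≤ G.natAbs := by
    refine (pow_card_le_prod _ _ _ fun p hp => ?_).trans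
      (Nat.le_of_dvd (Int.natAbs_pos.2 hG0) hprod)
    exact (hP p (mem_filter.1 hp).1).le
  have hnl : n ≤ l ^ (n - 1) := by
    have h3 : n - 1 < 2 ^ (n - 1) := Nat.lt_two_pow_self
    have h4 : 2 ^ (n - 1) ≤ l ^ (n - 1) := Nat.pow_le_pow_left hl _
    omega
  have hbase : n * (n * l ^ 2) ≤ l ^ (2 * n) := by
    calc n * (n * l ^ 2) ≤ l ^ (n - 1) * (l ^ (n - 1) * l ^ 2) := by gcongr
      _ = l ^ (2 * n) := by rw [← pow_add, ← pow_add]; congr 1; omega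
  have h2 : G.natAbs ≤ l ^ (2 * n ^ 2) := by
    have hr := (rowRank_le (fun x => (a x : ℚ)) A).trans htn
    calc G.natAbs ≤ (t * (n * l ^ 2)) ^ (rowRank (fun x => (a x : ℚ)) A) := by
          zify; exact hG
      _ ≤ (n * (n * l ^ 2)) ^ (rowRank (fun x => (a x : ℚ)) A) := by gcongr
      _ ≤ (n * (n * l ^ 2)) ^ n := Nat.pow_le_pow_right (by positivity) hr
      _ ≤ (l ^ (2 * n)) ^ n := by gcongr
      _ = _ := by rw [← pow_mul]; congr 1; ring
  exact (Nat.pow_le_pow_iff_right (by omega)).1 (h1.trans h2)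

/-! ### Residues of the entries -/

theorem entrySet_eq (l : ℕ) : entrySet l = Icc (-((l / 2 : ℕ) : ℤ)) (((l + 1) / 2 : ℕ) : ℤ) := by
  have h1 : ⌊(l : ℚ) / 2⌋ = ((l / 2 : ℕ) : ℤ) := by
    have := Rat.floor_intCast_div_natCast (l : ℤ) 2
    push_cast at this ⊢
    exact this
  have h2 : ⌈(l : ℚ) / 2⌉ = (((l + 1) / 2 : ℕ) : ℤ) := by
    rw [Int.ceil_eq_iff]
    have h3 : (((l + 1) / 2 : ℕ) : ℚ) * 2 ≤ l + 1 := by exact_mod_cast Nat.div_mul_le_self (l + 1) 2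
    have h4 : (l : ℚ) ≤ ((l + 1) / 2 : ℕ) * 2 := by
      exact_mod_cast (by omega : l ≤ (l + 1) / 2 * 2)
    constructor
    · rw [Int.cast_natCast]; linarith
    · rw [Int.cast_natCast]; linarith
  rw [entrySet, h1, h2]

theorem card_entrySet (l : ℕ) : #(entrySet l) = l + 1 := by
  rw [entrySet_eq, Int.card_Icc]
  omega

theorem abs_le_of_mem_entrySet {l : ℕ} (hl : 2 ≤ l) (x : entrySet l) : |(x : ℤ)| ≤ l := by
  obtain ⟨x, hx⟩ := x
  rw [entrySet_eq, mem_Icc] at hx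
  rw [abs_le]
  dsimp only
  omega

theorem prob_entrySet_eq (l : ℕ) (E : ℤ → Prop) [DecidablePred E] :
    prob (fun x : entrySet l => E x) = #((entrySet l).filter E) / (l + 1 : ℝ) := by
  have h := (sum_coe_sort (entrySet l) fun x => if E x then (1 : ℝ) else 0).trans (sum_boole _ _)
  rw [prob, Fintype.expect_eq_sum_div_card, Fintype.card_coe, card_entrySet, Nat.cast_succ, ← h]
  congr!

/-- If `g` is injective on `entrySet l`, then it takes no value with probability larger than
`1 / (l + 1)`. -/
theorem prob_eq_le_of_injOn {l : ℕ} {K : Type*} {g : ℤ → K} (hg : Set.InjOn g (entrySet l)) (c : K) :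
    prob (fun x : entrySet l => g x = c) ≤ 1 / (l + 1) := by
  rw [prob_entrySet_eq l fun x => g x = c]
  gcongr
  have : #{x ∈ entrySet l | g x = c} ≤ 1 := by
    refine card_le_one.2 fun x hx y hy => ?_
    rw [mem_filter] at hx hy
    exact hg hx.1 hy.1 (hx.2.trans hy.2.symm)
  exact_mod_cast this

theorem injOn_intCast_zmod {l p : ℕ} (hlp : l < p) :
    Set.InjOn (fun x : ℤ => (x : ZMod p)) (entrySet l) := by
  intro x hx y hy hxy
  rw [mem_coe, entrySet_eq, mem_Icc] at hx hy
  have h1 := (ZMod.intCast_eq_intCast_iff_dvd_sub x y p).1 hxy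
  have h2 := Int.eq_zero_of_abs_lt_dvd h1 (by rw [abs_lt]; omega)
  omega

/-- A residue class modulo `p ≤ l` has at most `(l + p) / p` of the `l + 1` contiguous integers,
which is at most the fraction `2 / (p + 1)` of them; equality holds for `l = p`. -/
theorem prob_intCast_zmod_eq_le {l p : ℕ} (hp : 0 < p) (hpl : p ≤ l) (c : ZMod p) :
    prob (fun x : entrySet l => ((x : ℤ) : ZMod p) = c) ≤ 2 / (p + 1) := by
  rw [prob_entrySet_eq l fun x : ℤ => (x : ZMod p) = c]
  set S := (entrySet l).filter fun x : ℤ => (x : ZMod p) = c with hS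
  have h1 : p * (#S - 1) ≤ l := by
    rcases S.eq_empty_or_nonempty with h | hne
    · simp [h]
    -- the elements of `S` differ by multiples of `p`
    obtain ⟨m, hmin, hmin_le⟩ := S.exists_min_image id hne
    simp only [id_eq] at hmin_le
    rw [hS, mem_filter, entrySet_eq, mem_Icc] at hmin
    have hsub : #S ≤ #(range (l / p + 1)) := by
      refine card_le_card_of_injOn (fun x => ((x - m) / p).toNat) ?_ ?_
      · intro x hx
        have hmx := hmin_le x hx
        rw [mem_coe, hS, mem_filter, entrySet_eq, mem_Icc] at hx
        have h2 : (x - m) / p ≤ ((l / p : ℕ) : ℤ) := by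
          rw [Int.natCast_div]
          exact Int.ediv_le_ediv (by exact_mod_cast hp) (by omega)
        have h3 : 0 ≤ (l : ℤ) / p := by positivity
        simp only [coe_range, Set.mem_Iio]
        omega
      · intro x hx y hy hxy
        have hmx := hmin_le x hx
        have hmy := hmin_le y hy
        rw [mem_coe, hS, mem_filter] at hx hy
        have d1 := (ZMod.intCast_eq_intCast_iff_dvd_sub m x p).1 (hmin.2.trans hx.2.symm)
        have d2 := (ZMod.intCast_eq_intCast_iff_dvd_sub m y p).1 (hmin.2.trans hy.2.symm)
        have n1 : 0 ≤ (x - m) / p := Int.ediv_nonneg (by omega) (by omega)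
        have n2 : 0 ≤ (y - m) / p := Int.ediv_nonneg (by omega) (by omega)
        have e1 := Int.ediv_mul_cancel d1
        have e2 := Int.ediv_mul_cancel d2
        have he : (x - m) / p = (y - m) / p := by
          simp only at hxy
          omega
        rw [he] at e1
        linarith
    rw [card_range] at hsub
    calc p * (#S - 1) ≤ p * (l / p) := Nat.mul_le_mul_left _ (Nat.sub_le_of_le_add hsub)
      _ ≤ l := Nat.mul_div_le l p
  rw [div_le_div_iff₀ (by positivity) (by positivity)]
  have h2 : #S * (p + 1) ≤ 2 * (l + 1) := by
    rcases Nat.lt_or_ge #S 2 with h | h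
    · nlinarith
    · obtain ⟨m, hm⟩ := Nat.exists_eq_add_of_le h
      rw [hm] at h1 ⊢
      have : 2 + m - 1 = m + 1 := by omega
      rw [this] at h1
      nlinarith
  exact_mod_cast h2

/-! ### Nontrivial invariant factors and ranks modulo primes -/

/-- A prime dividing the first nontrivial invariant factor divides all nontrivial ones, so that
modulo this prime their number is the nullity. -/
theorem exists_prime_numNontrivial_le {n : ℕ} (A : Matrix (Fin n) (Fin n) ℤ) :
    ∃ p : Nat.Primes, numNontrivial A ≤ n - (A.map (Int.cast : ℤ → ZMod p)).rank := by
  obtain ⟨hs0, hdvd, U, V, -, -, hA⟩ := invariantFactors_spec A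
  rw [numNontrivial]
  set s := invariantFactors A
  rcases (univ.filter fun i => s i ≠ 1).eq_empty_or_nonempty with h | hne
  · exact ⟨⟨2, Nat.prime_two⟩, by simp [h]⟩
  obtain ⟨i, hi, hmin⟩ := exists_min_image _ id hne
  have hi1 : (s i).natAbs ≠ 1 := by
    have := hs0 i
    have := (mem_filter.1 hi).2
    omega
  obtain ⟨p, hp, hpi⟩ := Nat.exists_prime_and_dvd hi1
  refine ⟨⟨p, hp⟩, ?_⟩
  have := Fact.mk hp
  change _ ≤ n - (A.map (Int.cast : ℤ → ZMod p)).rank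
  have hmap : A.map (Int.cast : ℤ → ZMod p) = U.map (Int.cast : ℤ → ZMod p) *
      Matrix.diagonal (fun i => (s i : ZMod p)) * V.map (Int.cast : ℤ → ZMod p) := by
    have h1 := Matrix.map_mul (L := U * Matrix.diagonal s) (M := V) (f := Int.castRingHom (ZMod p))
    rw [← hA, Matrix.map_mul, Matrix.diagonal_map (map_zero _)] at h1
    exact h1
  have hrank : (A.map (Int.cast : ℤ → ZMod p)).rank ≤ #{i | (s i : ZMod p) ≠ 0} := by
    rw [hmap]
    refine (Matrix.rank_mul_le_left _ _).trans ((Matrix.rank_mul_le_right _ _).trans ?_)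
    rw [Matrix.rank_diagonal, Fintype.card_subtype]
  have hsub : (univ.filter fun j => s j ≠ 1) ⊆
      (univ.filter fun j => (s j : ZMod p) ≠ 0)ᶜ := by
    intro j hj
    have hij : s i ∣ s j := hdvd i j (hmin j hj)
    simp only [mem_compl, mem_filter, mem_univ, true_and, not_not]
    exact (ZMod.intCast_zmod_eq_zero_iff_dvd _ _).2 ((Int.natCast_dvd.2 hpi).trans hij)
  have hc := card_le_card hsub
  rw [card_compl, Fintype.card_fin] at hc
  convert hc.trans (Nat.sub_le_sub_left hrank n)

theorem rank_map_eq_rowRank {K : Type*} [Field K] {σ : Type*} (a : σ → ℤ) {n t : ℕ}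
    (A : Fin t → Fin n → σ) :
    ((Matrix.of fun i j => a (A i j)).map (Int.cast : ℤ → K)).rank =
      rowRank (fun x => (a x : K)) A :=
  Matrix.rank_eq_finrank_span_row _

theorem expectedValue_eq_expect (n l : ℕ) (f : Matrix (Fin n) (Fin n) ℤ → ℝ) :
    expectedValue n l f =
      𝔼 A : Fin n → Fin n → entrySet l, f (Matrix.of fun i j => (A i j : ℤ)) := by
  rw [expectedValue, ← expect_eq_sum_div_card]
  symm
  refine expect_nbij (fun A => Matrix.of fun i j => (A i j : ℤ)) ?_ (fun _ _ => rfl) ?_ ?_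
  · intro A _
    simp [matrixSet]
  · intro A _ B _ h
    ext i j
    exact congrFun (congrFun h i) j
  · intro A hA
    have hA' : ∀ i j, A i j ∈ entrySet l := by
      rw [mem_coe, matrixSet, mem_map] at hA
      obtain ⟨B, hB, rfl⟩ := hA
      exact fun i j => Fintype.mem_piFinset.1 (Fintype.mem_piFinset.1 hB i) j
    exact ⟨fun i j => ⟨A i j, hA' i j⟩, mem_coe.2 (mem_univ _), rfl⟩

/-! ### Numerical estimates -/

theorem small_prime_ratio_le {p : ℕ} (hp : 2 ≤ p) :
    (1 - 2 / (p + 1 : ℝ))⁻¹ * (2 / (p + 1 : ℝ)) ^ (2 * 3 + 3) ≤ 1 / 10 := by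
  have hp' : (2 : ℝ) ≤ p := by exact_mod_cast hp
  have h1 : (1 - 2 / (p + 1 : ℝ))⁻¹ ≤ 3 := by
    rw [inv_le_comm₀ (by rw [sub_pos, div_lt_one] <;> linarith) (by norm_num), le_sub_comm,
      div_le_iff₀ (by linarith)]
    linarith
  have h2 : 2 / (p + 1 : ℝ) ≤ 2 / 3 := by gcongr; linarith
  calc _ ≤ 3 * (2 / 3 : ℝ) ^ (2 * 3 + 3) := by gcongr
    _ ≤ _ := by norm_num

/-- The factor `1 / 4` is nearly attained at `p = 2`; the telescoping form makes the sum over all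
primes at most `1 / 4`. -/
theorem small_prime_tail_le {p : ℕ} (hp : 2 ≤ p) :
    (1 - 2 / (p + 1 : ℝ))⁻¹ ^ (3 + 1) * (2 / (p + 1 : ℝ)) ^ ((3 + 1) * (3 + 1)) ≤
      1 / 4 * (1 / ((p : ℝ) - 1) - 1 / p) := by
  have hp' : (2 : ℝ) ≤ p := by exact_mod_cast hp
  generalize (p : ℝ) = x at hp'
  have e1 : (1 - 2 / (x + 1))⁻¹ = (x + 1) / (x - 1) := by
    rw [one_sub_div (by linarith), inv_div]; congr 1; ring
  have e2 : 1 / (x - 1) - 1 / x = 1 / ((x - 1) * x) := by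
    have : x - 1 ≠ 0 := by linarith
    have : x ≠ 0 := by linarith
    field_simp
    ring
  have h1 : 2 ^ 18 * x ≤ (x + 1) ^ 12 := by
    have h2 : (9 / 2 : ℝ) * x ≤ (x + 1) ^ 2 := by nlinarith
    have h3 : (3 : ℝ) ^ 10 ≤ (x + 1) ^ 10 := by gcongr; linarith
    calc 2 ^ 18 * x ≤ (9 / 2 * x) * 3 ^ 10 := by nlinarith
      _ ≤ (x + 1) ^ 2 * (x + 1) ^ 10 := by gcongr
      _ = _ := by ring
  have h4 : 1 ≤ (x - 1) ^ 3 := one_le_pow₀ (by linarith)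
  have hx1 : 0 < x - 1 := by linarith
  have e3 : ((x + 1) / (x - 1)) ^ (3 + 1) * (2 / (x + 1)) ^ ((3 + 1) * (3 + 1)) =
      2 ^ 16 / ((x - 1) ^ 4 * (x + 1) ^ 12) := by
    have : x + 1 ≠ 0 := by linarith
    rw [div_pow, div_pow]
    field_simp
    ring
  rw [e1, e2, e3, ← mul_div_assoc, mul_one, div_le_div_iff₀ (by positivity) (by positivity)]
  calc 2 ^ 16 * ((x - 1) * x) = 1 / 4 * (x - 1) * (1 * (2 ^ 18 * x)) := by ring
    _ ≤ 1 / 4 * (x - 1) * ((x - 1) ^ 3 * (x + 1) ^ 12) := by gcongr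
    _ = _ := by ring

theorem sum_primes_telescope_le (P : Finset Nat.Primes) :
    ∑ p ∈ P, (1 / (((p : ℕ) : ℝ) - 1) - 1 / ((p : ℕ) : ℝ)) ≤ 1 := by
  have hnn : ∀ i : ℕ, 0 ≤ 1 / ((i : ℝ) + 1) - 1 / ((i + 1 : ℕ) + 1 : ℝ) := by
    intro i
    rw [sub_nonneg]
    gcongr
    simp
  set M := P.sup (fun p => (p : ℕ))
  have hinj : Set.InjOn (fun p : Nat.Primes => (p : ℕ) - 2) P := by
    intro p _ q _ h
    have := p.2.two_le
    have := q.2.two_le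
    refine Subtype.ext ?_
    dsimp only at h
    omega
  calc _ = ∑ i ∈ P.image fun p : Nat.Primes => (p : ℕ) - 2,
          (1 / ((i : ℝ) + 1) - 1 / ((i + 1 : ℕ) + 1 : ℝ)) := by
        rw [sum_image hinj]
        refine sum_congr rfl fun p _ => ?_
        rw [Nat.cast_succ, Nat.cast_sub p.2.two_le]
        push_cast
        congr 2 <;> ring
    _ ≤ ∑ i ∈ range (M + 1), (1 / ((i : ℝ) + 1) - 1 / ((i + 1 : ℕ) + 1 : ℝ)) := by
        refine sum_le_sum_of_subset_of_nonneg ?_ fun i _ _ => hnn i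
        intro i hi
        obtain ⟨p, hp, rfl⟩ := mem_image.1 hi
        have : (p : ℕ) ≤ M := le_sup (f := fun p : Nat.Primes => (p : ℕ)) hp
        rw [mem_range]
        omega
    _ = 1 - 1 / ((M + 1 : ℕ) + 1 : ℝ) := by
        rw [sum_range_sub' fun i : ℕ => 1 / ((i : ℝ) + 1)]
        simp
    _ ≤ 1 := by
        have : (0 : ℝ) ≤ 1 / ((M + 1 : ℕ) + 1 : ℝ) := by positivity
        linarith

theorem sq_le_pow_ceil_sqrt_logb {n l : ℕ} (hn : 1 ≤ n) (hl : 2 ≤ l) :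
    n ^ 2 ≤ l ^ (⌈Real.sqrt (2 * Real.logb l n)⌉₊ ^ 2) := by
  set k := ⌈Real.sqrt (2 * Real.logb l n)⌉₊
  have hl' : (1 : ℝ) < l := by exact_mod_cast hl
  have h1 : 2 * Real.logb l n ≤ (k : ℝ) ^ 2 :=
    (Real.sqrt_le_left (Nat.cast_nonneg k)).1 (Nat.le_ceil _)
  have h2 : ((n ^ 2 : ℕ) : ℝ) ≤ ((l ^ k ^ 2 : ℕ) : ℝ) := by
    push_cast
    calc (n : ℝ) ^ 2 = ((l : ℝ) ^ Real.logb l n) ^ 2 := by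
          rw [Real.rpow_logb (by linarith) hl'.ne' (by exact_mod_cast hn)]
      _ = (l : ℝ) ^ (2 * Real.logb l n) := by
          rw [← Real.rpow_natCast, ← Real.rpow_mul (by linarith), mul_comm]; rfl
      _ ≤ (l : ℝ) ^ ((k : ℝ) ^ 2) := Real.rpow_le_rpow_of_exponent_le hl'.le h1
      _ = (l : ℝ) ^ k ^ 2 := by rw [← Nat.cast_pow, Real.rpow_natCast]
  exact_mod_cast h2

/-- The total expectation contributed by the large primes is negligible. -/
theorem large_prime_tail_le {n l k : ℕ} (hl : 2 ≤ l) (hnk : n ^ 2 ≤ l ^ k ^ 2) :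
    10 / 9 * (((2 * n ^ 2 : ℕ) : ℝ) * ((1 - 1 / (l + 1 : ℝ))⁻¹ ^ (k + 2) *
      (1 / (l + 1 : ℝ)) ^ ((k + 2) * (k + 2 + 1)))) ≤ 1 / 10 := by
  have hl' : (2 : ℝ) ≤ l := by exact_mod_cast hl
  have hnk' : (n : ℝ) ^ 2 ≤ (l : ℝ) ^ k ^ 2 := by exact_mod_cast hnk
  have hc : (1 - 1 / (l + 1 : ℝ))⁻¹ * (1 / (l + 1 : ℝ)) ≤ 1 := by
    rw [one_sub_div (by linarith), inv_div, div_mul_div_comm, div_le_one (by nlinarith)]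
    nlinarith
  have hβ : 1 / (l + 1 : ℝ) ≤ 1 / 3 := by gcongr; linarith
  have hlβ : (l : ℝ) * (1 / (l + 1)) ≤ 1 := by
    rw [mul_one_div, div_le_one (by linarith)]; linarith
  have hc0 : 0 ≤ (1 - 1 / (l + 1 : ℝ))⁻¹ := by
    rw [inv_nonneg]; linarith
  set c := (1 - 1 / (l + 1 : ℝ))⁻¹
  set β := 1 / (l + 1 : ℝ)
  have hβ0 : 0 ≤ β := by positivity
  have e1 : c ^ (k + 2) * β ^ ((k + 2) * (k + 2 + 1)) =
      (c * β) ^ (k + 2) * β ^ (4 * k) * (β ^ 4 * β ^ k ^ 2) := by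
    ring
  have hβ4 : β ^ 4 ≤ (1 / 3) ^ 4 := by gcongr
  have h1 : (n : ℝ) ^ 2 * β ^ k ^ 2 ≤ 1 := by
    calc (n : ℝ) ^ 2 * β ^ k ^ 2 ≤ (l : ℝ) ^ k ^ 2 * β ^ k ^ 2 := by gcongr
      _ = (l * β) ^ k ^ 2 := by rw [mul_pow]
      _ ≤ 1 := pow_le_one₀ (by positivity) hlβ
  calc _ = 20 / 9 * ((c * β) ^ (k + 2) * β ^ (4 * k) * β ^ 4 * (n ^ 2 * β ^ k ^ 2)) := by
        rw [e1]; push_cast; ring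
    _ ≤ 20 / 9 * (1 * 1 * (1 / 3) ^ 4 * 1) := by
        gcongr
        · exact pow_le_one₀ (by positivity) hc
        · exact pow_le_one₀ (by positivity) (by linarith)
    _ ≤ _ := by norm_num

/-- The bound on the expectation in terms of any `k ≥ 1` with `n ^ 2 ≤ l ^ (k ^ 2)`. -/
theorem expectedValue_numNontrivial_le {n l k : ℕ} (hl : 2 ≤ l) (hk : 1 ≤ k)
    (hnk : n ^ 2 ≤ l ^ k ^ 2) :
    expectedValue n l (fun A => (numNontrivial A : ℝ)) ≤ k + 3 := by
  have hl' : (2 : ℝ) ≤ l := by exact_mod_cast hl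
  have : Nonempty (entrySet l) :=
    (card_pos.1 (by rw [card_entrySet]; omega) : (entrySet l).Nonempty).to_subtype
  let a : entrySet l → ℤ := fun x => x
  let M : (Fin n → Fin n → entrySet l) → Matrix (Fin n) (Fin n) ℤ :=
    fun A => Matrix.of fun i j => a (A i j)
  let rQ : (Fin n → Fin n → entrySet l) → ℕ := rowRank fun x => (a x : ℚ)
  let r : Nat.Primes → (Fin n → Fin n → entrySet l) → ℕ := fun p =>
    rowRank fun x => (a x : ZMod p)
  -- finitely many primes suffice, as there are finitely many matrices
  choose q hq using fun A => exists_prime_numNontrivial_le (M A)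
  let P : Finset Nat.Primes := univ.image q
  let P₁ := P.filter fun p : Nat.Primes => (p : ℕ) ≤ l
  let P₂ := P.filter fun p : Nat.Primes => ¬ (p : ℕ) ≤ l
  -- a prime `q A > l` is paid for by the rational nullity and the excess at `q A`; for `q A ≤ l`
  -- the threshold `3` suffices because `3 ≤ k + 2`
  have hpoint : ∀ A, (numNontrivial (M A) : ℝ) ≤ (k + 2 : ℕ) + ((n - rQ A - 0 : ℕ) : ℝ) +
      ∑ p ∈ P₁, ((n - r p A - 3 : ℕ) : ℝ) + ∑ p ∈ P₂, ((rQ A - r p A - (k + 2) : ℕ) : ℝ) := by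
    intro A
    have h := hq A
    rw [rank_map_eq_rowRank] at h
    change _ ≤ n - r (q A) A at h
    have hqP : q A ∈ P := mem_image_of_mem _ (mem_univ _)
    norm_cast
    by_cases hql : (q A : ℕ) ≤ l
    · have : n - r (q A) A - 3 ≤ ∑ p ∈ P₁, (n - r p A - 3) :=
        single_le_sum (f := fun p => n - r p A - 3) (fun p _ => Nat.zero_le _)
          (mem_filter.2 ⟨hqP, hql⟩)
      omega
    · have : rQ A - r (q A) A - (k + 2) ≤ ∑ p ∈ P₂, (rQ A - r p A - (k + 2)) :=
        single_le_sum (f := fun p => rQ A - r p A - (k + 2)) (fun p _ => Nat.zero_le _)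
          (mem_filter.2 ⟨hqP, hql⟩)
      have := rowRank_le (fun x => (a x : ℚ)) A
      change rQ A ≤ n at this
      omega
  have hβ1 : 1 / (l + 1 : ℝ) < 1 := by rw [div_lt_one] <;> linarith
  have hcβ : (1 - 1 / (l + 1 : ℝ))⁻¹ * (1 / (l + 1 : ℝ)) ≤ 1 / 2 := by
    rw [one_sub_div (by linarith), inv_div, div_mul_div_comm, div_le_div_iff₀ (by nlinarith)
      (by norm_num)]
    nlinarith
  have hβ3 : 1 / (l + 1 : ℝ) ≤ 1 / 3 := by gcongr; linarith
  have hratio : ∀ m, (1 - 1 / (l + 1 : ℝ))⁻¹ * (1 / (l + 1 : ℝ)) ^ (m + 3) ≤ 1 / 10 := by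
    intro m
    have hc0 : 0 ≤ (1 - 1 / (l + 1 : ℝ))⁻¹ * (1 / (l + 1 : ℝ)) :=
      mul_nonneg (inv_nonneg.2 (by linarith)) (by positivity)
    calc _ = (1 - 1 / (l + 1 : ℝ))⁻¹ * (1 / (l + 1 : ℝ)) *
          ((1 / (l + 1 : ℝ)) ^ 2 * (1 / (l + 1 : ℝ)) ^ m) := by ring
      _ ≤ 1 / 2 * ((1 / 3) ^ 2 * 1) := by
          gcongr
          exact pow_le_one₀ (by positivity) hβ1.le
      _ ≤ _ := by norm_num
  -- the rational nullity
  have hQ : 𝔼 A, ((n - rQ A - 0 : ℕ) : ℝ) ≤ 5 / 9 := by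
    refine (expect_nullity_le (fun c => prob_eq_le_of_injOn (g := fun x : ℤ => (x : ℚ))
      (Int.cast_injective.injOn) c) hβ1 (hratio 0)).trans ?_
    simp only [zero_add, pow_one, mul_one]
    linarith
  have h₁ : ∑ p ∈ P₁, 𝔼 A, ((n - r p A - 3 : ℕ) : ℝ) ≤ 5 / 18 := by
    calc _ ≤ ∑ p ∈ P₁, 10 / 9 * (1 / 4 * (1 / (((p : ℕ) : ℝ) - 1) - 1 / ((p : ℕ) : ℝ))) := by
          refine sum_le_sum fun p hp => ?_
          have hp2 : (2 : ℝ) ≤ (p : ℕ) := by exact_mod_cast p.2.two_le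
          refine (expect_nullity_le (fun c => prob_intCast_zmod_eq_le p.2.pos (mem_filter.1 hp).2 c)
            (by rw [div_lt_one] <;> linarith) (small_prime_ratio_le p.2.two_le)).trans ?_
          exact mul_le_mul_of_nonneg_left (small_prime_tail_le p.2.two_le) (by norm_num)
      _ = 5 / 18 * ∑ p ∈ P₁, (1 / (((p : ℕ) : ℝ) - 1) - 1 / ((p : ℕ) : ℝ)) := by
          rw [mul_sum]
          exact sum_congr rfl fun p _ => by ring
      _ ≤ 5 / 18 * 1 := by gcongr; exact sum_primes_telescope_le P₁
      _ = _ := by ring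
  have hP₂ : ∀ p ∈ P₂, l < (p : ℕ) := fun p hp => not_le.1 (mem_filter.1 hp).2
  have h₂ : ∑ p ∈ P₂, 𝔼 A, ((rQ A - r p A - (k + 2) : ℕ) : ℝ) ≤ 1 / 10 := by
    refine (sum_expect_excess_le (fun x => (a x : ℚ)) P₂ (K := fun p : Nat.Primes => ZMod p)
      (fun p x => (a x : ZMod p)) (β := 1 / (l + 1 : ℝ)) (N := (2 * n ^ 2 : ℕ)) (by positivity)
      (fun p hp c => prob_eq_le_of_injOn (injOn_intCast_zmod (hP₂ p hp)) c) hβ1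
      (fun t ht A => ?_) ?_).trans (large_prime_tail_le hl hnk)
    · have := card_rowRank_lt_le a hl (abs_le_of_mem_entrySet hl) ht A P₂ hP₂
      exact_mod_cast this
    · exact hratio (2 * k + 3)
  rw [expectedValue_eq_expect]
  calc _ ≤ 𝔼 A, ((k + 2 : ℕ) + ((n - rQ A - 0 : ℕ) : ℝ) +
      ∑ p ∈ P₁, ((n - r p A - 3 : ℕ) : ℝ) + ∑ p ∈ P₂, ((rQ A - r p A - (k + 2) : ℕ) : ℝ)) :=
        expect_le_expect fun A _ => hpoint A
    _ = (k + 2 : ℕ) + 𝔼 A, ((n - rQ A - 0 : ℕ) : ℝ) + ∑ p ∈ P₁, 𝔼 A, ((n - r p A - 3 : ℕ) : ℝ) +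
        ∑ p ∈ P₂, 𝔼 A, ((rQ A - r p A - (k + 2) : ℕ) : ℝ) := by
        rw [expect_add_distrib, expect_add_distrib, expect_add_distrib, expect_sum_comm,
          expect_sum_comm, expect_const univ_nonempty]
    _ ≤ _ := by push_cast; linarith

end RandomSmith

theorem mainTheorem2 (n l : ℕ) (hn : 1 ≤ n) (hl : 2 ≤ l) :
    RandomSmith.expectedValue n l (fun A => (RandomSmith.numNontrivial A : ℝ)) ≤
        (⌈Real.sqrt (2 * Real.logb l n)⌉ : ℝ) + 3 ∧
      (⌈Real.sqrt (2 * Real.logb l n)⌉ : ℝ) + 3 < 3 * (⌈Real.logb l n⌉ : ℝ) + 29 := by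
  have hl' : (1 : ℝ) < l := by exact_mod_cast hl
  constructor
  · rw [← natCast_ceil_eq_intCast_ceil (Real.sqrt_nonneg _)]
    rcases hn.eq_or_lt with rfl | hn2
    · -- a `1 × 1` matrix has only one invariant factor
      rw [RandomSmith.expectedValue_eq_expect]
      have : Nonempty (RandomSmith.entrySet l) :=
        (Finset.card_pos.1 (by rw [RandomSmith.card_entrySet]; omega) :
          (RandomSmith.entrySet l).Nonempty).to_subtype
      refine Finset.expect_le Finset.univ_nonempty fun A _ => ?_
      have h1 : RandomSmith.numNontrivial (Matrix.of fun i j => (A i j : ℤ)) ≤ 1 :=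
        (Finset.card_le_univ _).trans_eq (Fintype.card_fin 1)
      have h2 : (RandomSmith.numNontrivial (Matrix.of fun i j => (A i j : ℤ)) : ℝ) ≤ 1 := by
        exact_mod_cast h1
      have h3 : (0 : ℝ) ≤ (⌈Real.sqrt (2 * Real.logb l (1 : ℕ))⌉₊ : ℝ) := Nat.cast_nonneg _
      linarith
    · refine RandomSmith.expectedValue_numNontrivial_le hl ?_
        (RandomSmith.sq_le_pow_ceil_sqrt_logb hn hl)
      have : 0 < Real.logb l n := Real.logb_pos hl' (by exact_mod_cast hn2)
      exact Nat.ceil_pos.2 (Real.sqrt_pos.2 (by linarith))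
  · have h0 : 0 ≤ Real.logb l n := Real.logb_nonneg hl' (by exact_mod_cast hn)
    have h1 := Int.ceil_lt_add_one (Real.sqrt (2 * Real.logb l n))
    have h2 := Int.le_ceil (Real.logb l n)
    have h3 : Real.sqrt (2 * Real.logb l n) ≤ Real.logb l n + 1 := by
      rw [Real.sqrt_le_left (by linarith)]
      nlinarith [sq_nonneg (Real.logb l n)]
    linarith
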